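/- Let $\mathcal V=\{1,\dots,n\}$ be a set of agents, $\emptyset\ne\mathcal S\subset\mathcal V$ the set of agents that receive noise, $\epsilon\in(0,1]$ and $x(0)\in[0,1]^n$. The noisy Hegselmann--Krause system is $$x_i(t+1)=\min\{1,\max\{0,x_i^*(t)\}\},\qquad x_i^*(t)=\frac1{|\mathcal N_i(t)|}\sum_{j\in\mathcal N_i(t)}x_j(t)+I_{\{i\in\mathcal S\}}\,\xi_i(t+1),\qquad i\in\mathcal V,\ t\ge 0,$$ where $\mathcal N_i(t)=\{j\in\mathcal V:|x_j(t)-x_i(t)|\le\epsilon\}$. Let $d_{\mathcal V}(t)=\max_{i,j\in\mathcal V}|x_i(t)-x_j(t)|$ and $T=\min\{t\ge 0: d_{\mathcal V}(t')\le\epsilon\text{ for all }t'\ge t\}$, with $T=\infty$ if there is no such $t$. Suppose that the random variables $\xi_i(t)$, $i\in\mathcal V$, $t\ge 1$, are independent and that (i) $P\{|\xi_i(t)|\le\delta\}=1$ for all $i,t$, where $\delta\in(0,\epsilon]$ if $|\mathcal S|=1$, and $\delta\in(0,\epsilon/2]$ if $|\mathcal S|>1$; (ii) there are constants $a\in(0,\delta)$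 and $p\in(0,1)$ such that, for all $i\in\mathcal V$ and $t\ge1$, each of the events $\{\xi_i(t)\ge a\}$, $\{0\le\xi_i(t)\le a\}$, $\{\xi_i(t)\le -a\}$, $\{-a\le\xi_i(t)\le 0\}$ has probability at least $p$. Then, for every such $x(0)$ and $\epsilon$, almost surely $T<\infty$ (the system attains a quasi-consensus in finite time), and almost surely, for every $t>T$, $d_{\mathcal V}(t)\le\delta$ if $|\mathcal S|=1$, and $d_{\mathcal V}(t)\le2\delta$ if $|\mathcal S|>1$. -/

import Mathlib

open MeasureTheory ProbabilityTheory

namespace NoisyHK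

noncomputable section

/-- The neighbours of agent `i` in the opinion profile `x`, for the confidence threshold `ε`
(agent `i` itself is one of them when `0 ≤ ε`). -/
def neighbors {n : ℕ} (ε : ℝ) (x : Fin n → ℝ) (i : Fin n) : Finset (Fin n) :=
  Finset.univ.filter (fun j => |x j - x i| ≤ ε)

/-- The average opinion over the neighbours of agent `i`. -/
def localMean {n : ℕ} (ε : ℝ) (x : Fin n → ℝ) (i : Fin n) : ℝ :=
  ((neighbors ε x i).card : ℝ)⁻¹ * ∑ j ∈ neighbors ε x i, x j

/-- Truncation to `[0, 1]`: the value is `1` if `1 < y`, `0` if `y < 0`, and `y` otherwise. -/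
def clip (y : ℝ) : ℝ :=
  if 1 < y then 1 else if y < 0 then 0 else y

/-- One step of the noisy Hegselmann-Krause dynamics; only the agents in `S` receive
their noise `w i`. -/
def step {n : ℕ} (ε : ℝ) (S : Finset (Fin n)) (w : Fin n → ℝ) (x : Fin n → ℝ) : Fin n → ℝ :=
  fun i => clip (localMean ε x i + if i ∈ S then w i else 0)

/-- The opinion profile at time `t`, started at `x₀` and driven by the noise `w i t`, `t ≥ 1`:
the noise used in the step from time `t` to time `t + 1` is `w i (t + 1)`. -/
def state {n : ℕ} (ε : ℝ) (S : Finset (Fin n)) (w : Fin n → ℕ+ → ℝ) (x₀ : Fin n → ℝ) :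
    ℕ → Fin n → ℝ
  | 0 => x₀
  | t + 1 => step ε S (fun i => w i t.succPNat) (state ε S w x₀ t)

/-- The opinion diameter, the maximum of `|x i - x j|` over all pairs of agents. -/
def diam {n : ℕ} (x : Fin n → ℝ) : ℝ :=
  ⨆ q : Fin n × Fin n, |x q.1 - x q.2|

/-- The least time from which on the opinion diameter of the trajectory `x` never exceeds `ε`;
it is `⊤` if there is no such time. -/
def quasiConsensusTime {n : ℕ} (ε : ℝ) (x : ℕ → Fin n → ℝ) : ℕ∞ :=
  ⨅ (t : ℕ) (_ : ∀ t' : ℕ, t ≤ t' → diam (x t') ≤ ε), (t : ℕ∞)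

end

end NoisyHK

/-! Profiles of diameter at most `ε` form an absorbing set: there all agents are neighbours and
share one mean, so after a step opinions differ only through the noise, by at most `δ` for one noisy
agent and `2 * δ` for several; either is at most `ε`. It remains to reach this set almost surely.
All noises of a step fall into one prescribed quarter with probability at least `p ^ n`, so it
suffices that a controller who chooses the quarters reaches agreement in a number of steps bounded
uniformly over the cube (`cube_leadsTo_agreement`); the failure probability then decays
geometrically (`ae_exists_mem`).

The controller raises a lower bound `v` of all opinions by `c / n` at a time (`above_leadsTo`). One
opinion in the window `[v + c, v + ε]` is enough, because it lifts every mean. To place one there,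
nonnegative noise first makes clusters narrow. Then a low noisy agent is pushed up into the window,
or, if all noisy agents are high, they are pulled down. A single noisy agent may jump over the
window; then either it can be pushed back up into a window, or a noiseless agent linked to both
sides averages into the window.

Clustering and pulling terminate by `potential_localMean_le`: averaging lowers a rank-weighted sum
by at least the gap between any two neighbours. -/

namespace NoisyHK

/-! ### Local means: bounds and order preservation. -/

section Averages

variable {n : ℕ} {ε : ℝ} {x : Fin n → ℝ} {i j k : Fin n} {b d : ℝ}

lemma mem_neighbors : j ∈ neighbors ε x i ↔ |x j - x i| ≤ ε := by
  simp [neighbors]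

lemma self_mem_neighbors (hε : 0 ≤ ε) (x : Fin n → ℝ) (i : Fin n) : i ∈ neighbors ε x i := by
  simpa [mem_neighbors] using hε

lemma mem_neighbors_comm : j ∈ neighbors ε x i ↔ i ∈ neighbors ε x j := by
  rw [mem_neighbors, mem_neighbors, abs_sub_comm]

lemma card_neighbors_pos (hε : 0 ≤ ε) (x : Fin n → ℝ) (i : Fin n) :
    (0 : ℝ) < (neighbors ε x i).card := by
  exact_mod_cast Finset.card_pos.2 ⟨i, self_mem_neighbors hε x i⟩

lemma card_neighbors_le (x : Fin n → ℝ) (i : Fin n) :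
    ((neighbors ε x i).card : ℝ) ≤ n := by
  exact_mod_cast (Finset.card_le_univ _).trans_eq (Fintype.card_fin n)

lemma localMean_sub (hε : 0 ≤ ε) (x : Fin n → ℝ) (i : Fin n) (b : ℝ) :
    localMean ε x i - b = ((neighbors ε x i).card : ℝ)⁻¹ * ∑ j ∈ neighbors ε x i, (x j - b) := by
  have := (card_neighbors_pos hε x i).ne'
  rw [Finset.sum_sub_distrib, Finset.sum_const, nsmul_eq_mul, localMean]
  field_simp

lemma localMean_neg (ε : ℝ) (x : Fin n → ℝ) : localMean ε (-x) = -localMean ε x := by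
  ext i
  have h : neighbors ε (-x) i = neighbors ε x i := by
    ext j
    rw [mem_neighbors, mem_neighbors, Pi.neg_apply, Pi.neg_apply, neg_sub_neg, abs_sub_comm]
  simp [localMean, h]

lemma le_localMean (hε : 0 ≤ ε) (h : ∀ j ∈ neighbors ε x i, b ≤ x j) : b ≤ localMean ε x i := by
  rw [← sub_nonneg, localMean_sub hε]
  exact mul_nonneg (by positivity) (Finset.sum_nonneg fun j hj => sub_nonneg.2 (h j hj))

lemma lt_localMean (hε : 0 ≤ ε) (h : ∀ j ∈ neighbors ε x i, b < x j) : b < localMean ε x i := by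
  rw [← sub_pos, localMean_sub hε]
  exact mul_pos (inv_pos.2 (card_neighbors_pos hε x i))
    (Finset.sum_pos (fun j hj => sub_pos.2 (h j hj)) ⟨i, self_mem_neighbors hε x i⟩)

lemma localMean_le (hε : 0 ≤ ε) (h : ∀ j ∈ neighbors ε x i, x j ≤ b) : localMean ε x i ≤ b := by
  have := le_localMean (x := -x) (i := i) (b := -b) hε fun j hj => by
    rw [mem_neighbors, Pi.neg_apply, Pi.neg_apply, neg_sub_neg, abs_sub_comm,
      ← mem_neighbors] at hj
    exact neg_le_neg (h j hj)
  rw [localMean_neg] at this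
  exact neg_le_neg_iff.1 this

lemma localMean_lt (hε : 0 ≤ ε) (h : ∀ j ∈ neighbors ε x i, x j < b) : localMean ε x i < b := by
  have := lt_localMean (x := -x) (i := i) (b := -b) hε fun j hj => by
    rw [mem_neighbors, Pi.neg_apply, Pi.neg_apply, neg_sub_neg, abs_sub_comm,
      ← mem_neighbors] at hj
    exact neg_lt_neg (h j hj)
  rw [localMean_neg] at this
  exact neg_lt_neg_iff.1 this

/-- One neighbour lying `d` above a common lower bound lifts the local mean by `d / n`. -/
lemma add_div_le_localMean (hε : 0 ≤ ε) (hd : 0 ≤ d) (h : ∀ j ∈ neighbors ε x i, b ≤ x j)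
    (hk : k ∈ neighbors ε x i) (hkd : b + d ≤ x k) : b + d / n ≤ localMean ε x i := by
  have hc := card_neighbors_pos hε x i
  have hs : d ≤ ∑ j ∈ neighbors ε x i, (x j - b) :=
    (by linarith : d ≤ x k - b).trans
      (Finset.single_le_sum (f := fun j => x j - b) (fun j hj => sub_nonneg.2 (h j hj)) hk)
  have : d / n ≤ localMean ε x i - b := by
    rw [localMean_sub hε, inv_mul_eq_div]
    exact div_le_div₀ (hd.trans hs) hs hc (card_neighbors_le x i)
  linarith

lemma localMean_le_sub_div (hε : 0 ≤ ε) (hd : 0 ≤ d) (h : ∀ j ∈ neighbors ε x i, x j ≤ b)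
    (hk : k ∈ neighbors ε x i) (hkd : x k ≤ b - d) : localMean ε x i ≤ b - d / n := by
  have hN : ∀ j, j ∈ neighbors ε (-x) i ↔ j ∈ neighbors ε x i := fun j => by
    rw [mem_neighbors, mem_neighbors, Pi.neg_apply, Pi.neg_apply, neg_sub_neg, abs_sub_comm]
  have := add_div_le_localMean (x := -x) (i := i) (k := k) (b := -b) hε hd
    (fun j hj => neg_le_neg (h j ((hN j).1 hj))) ((hN k).2 hk)
    (by rw [Pi.neg_apply]; linarith)
  rw [localMean_neg, Pi.neg_apply] at this
  linarith

/-- Averaging over neighbours preserves the order of the agents. -/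
lemma localMean_mono (hε : 0 ≤ ε) (h : x i ≤ x j) : localMean ε x i ≤ localMean ε x j := by
  have hi := card_neighbors_pos hε x i
  have hj := card_neighbors_pos hε x j
  let I : Fin n → Fin n → ℝ := fun i k => if k ∈ neighbors ε x i then 1 else 0
  have hI : ∀ i, ((neighbors ε x i).card : ℝ) = ∑ k, I i k := fun i => by simp [I]
  have hX : ∀ i, ∑ k ∈ neighbors ε x i, x k = ∑ k, I i k * x k := fun i => by simp [I]
  -- The cross-multiplied inequality, antisymmetrised. Each term is nonnegative: for `x k < x l`, if
  -- `l` is seen from `i` and `k` from `j`, then also `k` from `i` and `l` from `j`.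
  have key : 0 ≤ ∑ k, ∑ l, (I i k * I j l - I i l * I j k) * (x l - x k) := by
    refine Finset.sum_nonneg fun k _ => Finset.sum_nonneg fun l _ => ?_
    simp only [I, mem_neighbors, abs_le]
    split_ifs <;> grind
  have e1 : ∑ k, ∑ l, I i k * I j l * (x l - x k)
      = (∑ k, I i k) * (∑ l, I j l * x l) - (∑ k, I i k * x k) * ∑ l, I j l := by
    rw [Finset.sum_mul_sum, Finset.sum_mul_sum, ← Finset.sum_sub_distrib]
    refine Finset.sum_congr rfl fun k _ => ?_
    rw [← Finset.sum_sub_distrib]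
    exact Finset.sum_congr rfl fun l _ => by ring
  have e2 : ∑ k, ∑ l, I i l * I j k * (x l - x k)
      = -∑ k, ∑ l, I i k * I j l * (x l - x k) := by
    rw [Finset.sum_comm, ← Finset.sum_neg_distrib]
    refine Finset.sum_congr rfl fun k _ => ?_
    rw [← Finset.sum_neg_distrib]
    exact Finset.sum_congr rfl fun l _ => by ring
  simp only [sub_mul, Finset.sum_sub_distrib] at key
  simp only [e2, e1] at key
  rw [localMean, localMean, inv_mul_eq_div, inv_mul_eq_div, div_le_div_iff₀ hi hj, hI, hI, hX, hX]
  linarith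

end Averages

/-! ### Truncation. -/

section Clip

variable {y z : ℝ}

lemma clip_eq (y : ℝ) : clip y = min 1 (max 0 y) := by
  rw [clip]
  split_ifs <;> grind

lemma clip_mem (y : ℝ) : clip y ∈ Set.Icc (0 : ℝ) 1 := by
  rw [clip_eq]; constructor <;> simp

lemma clip_mono (h : y ≤ z) : clip y ≤ clip z := by
  rw [clip_eq, clip_eq]; gcongr

lemma clip_of_mem (h : y ∈ Set.Icc (0 : ℝ) 1) : clip y = y := by
  rw [clip_eq, max_eq_right h.1, min_eq_right h.2]

lemma abs_clip_sub_clip_le (y z : ℝ) : |clip y - clip z| ≤ |y - z| := by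
  simp only [clip]
  split_ifs <;> grind

@[fun_prop]
lemma measurable_clip : Measurable clip := by
  have : clip = fun y => min 1 (max 0 y) := funext clip_eq
  rw [this]; fun_prop

end Clip

/-! ### A potential lowered by averaging. -/

section Potential

variable {n : ℕ} {ε : ℝ} {x y z : Fin n → ℝ}

/-- The maximum over all rankings `σ` of the agents of the weighted sum of opinions in which the
agent of rank `r` has weight `(2 * n) ^ r`. -/
noncomputable def potential (x : Fin n → ℝ) : ℝ :=
  ⨆ σ : Equiv.Perm (Fin n), ∑ i, (2 * n : ℝ) ^ (σ i : ℕ) * x i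

lemma sum_le_potential (x : Fin n → ℝ) (σ : Equiv.Perm (Fin n)) :
    ∑ i, (2 * n : ℝ) ^ (σ i : ℕ) * x i ≤ potential x :=
  le_ciSup (f := fun σ : Equiv.Perm (Fin n) => ∑ i, (2 * n : ℝ) ^ (σ i : ℕ) * x i)
    (Set.finite_range _).bddAbove σ

lemma potential_le {b : ℝ}
    (h : ∀ σ : Equiv.Perm (Fin n), ∑ i, (2 * n : ℝ) ^ (σ i : ℕ) * x i ≤ b) : potential x ≤ b :=
  ciSup_le h

lemma potential_mono (h : x ≤ y) : potential x ≤ potential y :=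
  potential_le fun σ => (Finset.sum_le_sum fun i _ =>
    mul_le_mul_of_nonneg_left (h i) (by positivity)).trans (sum_le_potential y σ)

lemma one_le_weight (i : Fin n) (r : ℕ) : (1 : ℝ) ≤ (2 * n : ℝ) ^ r := by
  have : (1 : ℝ) ≤ n := by exact_mod_cast i.pos
  exact one_le_pow₀ (by linarith)

lemma potential_le_sub {a : ℝ} (ha : 0 ≤ a) (h : y ≤ z) (i : Fin n) (hi : y i ≤ z i - a) :
    potential y ≤ potential z - a := by
  refine potential_le fun σ => ?_
  have h1 : a ≤ ∑ j, (2 * n : ℝ) ^ (σ j : ℕ) * (z j - y j) := by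
    refine le_trans ?_ (Finset.single_le_sum (f := fun j => (2 * n : ℝ) ^ (σ j : ℕ) * (z j - y j))
      (fun j _ => mul_nonneg (by positivity) (sub_nonneg.2 (h j))) (Finset.mem_univ i))
    nlinarith [one_le_weight i (σ i : ℕ)]
  simp only [mul_sub, Finset.sum_sub_distrib] at h1
  linarith [sum_le_potential z σ]

lemma abs_potential_le (h : ∀ i, |x i| ≤ 1) :
    |potential x| ≤ ∑ r : Fin n, (2 * n : ℝ) ^ (r : ℕ) := by
  have key : ∀ σ : Equiv.Perm (Fin n), |∑ i, (2 * n : ℝ) ^ (σ i : ℕ) * x i|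
      ≤ ∑ r : Fin n, (2 * n : ℝ) ^ (r : ℕ) := fun σ => by
    rw [← Equiv.sum_comp σ fun r : Fin n => (2 * n : ℝ) ^ (r : ℕ)]
    refine (Finset.abs_sum_le_sum_abs _ _).trans (Finset.sum_le_sum fun i _ => ?_)
    rw [abs_mul, abs_of_nonneg (by positivity)]
    exact mul_le_of_le_one_right (by positivity) (h i)
  refine abs_le.2 ⟨?_, potential_le fun σ => (le_abs_self _).trans (key σ)⟩
  linarith [(abs_le.1 (key 1)).1, sum_le_potential x 1]

/-- Averaging lowers the potential by at least the distance of any two neighbours. -/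
lemma potential_localMean_le (hε : 0 ≤ ε) {i j : Fin n} (hij : j ∈ neighbors ε x i) :
    potential (localMean ε x) ≤ potential x - |x j - x i| := by
  set σ : Equiv.Perm (Fin n) := (Tuple.sort x)⁻¹ with hσ
  set w : Fin n → ℝ := fun i => (2 * n : ℝ) ^ (σ i : ℕ) with hw
  have hn : (1 : ℝ) ≤ n := by exact_mod_cast i.pos
  have hsort : ∀ k l, σ k ≤ σ l → x k ≤ x l := fun k l h => by
    simpa [hσ] using Tuple.monotone_sort x h
  have hwpos : ∀ k, 0 < w k := fun k => by positivity
  have hlt : ∀ k l, x k < x l → σ k < σ l := fun k l h => by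
    by_contra hc
    exact absurd (hsort l k (not_lt.1 hc)) (not_le.2 h)
  -- Means are ordered like opinions, so by rearrangement the ranking that sorts `x` is also optimal
  -- for the means.
  have hmono : Monovary w (localMean ε x) := fun k l h => by
    have h1 : x k < x l := by
      by_contra hc
      exact absurd (localMean_mono hε (not_lt.1 hc)) (not_le.2 h)
    exact pow_le_pow_right₀ (by linarith) (hlt k l h1).le
  have h1 : potential (localMean ε x) ≤ ∑ k, w k * localMean ε x k := by
    refine potential_le fun π => ?_
    have := hmono.sum_comp_perm_mul_le_sum_mul (σ := σ⁻¹ * π)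
    simpa [hw] using this
  have h2 : ∑ k, w k * x k ≤ potential x := sum_le_potential x σ
  set c : Fin n → ℝ := fun k => ((neighbors ε x k).card : ℝ) with hc
  have hcpos : ∀ k, 0 < c k := fun k => card_neighbors_pos hε x k
  have hc1 : ∀ k, 1 ≤ c k := fun k => by
    have := Finset.card_pos.2 ⟨k, self_mem_neighbors hε x k⟩
    simp only [hc]
    exact_mod_cast this
  let I : Fin n → Fin n → ℝ := fun k l => if l ∈ neighbors ε x k then 1 else 0
  have hIsymm : ∀ k l, I k l = I l k := fun k l => by
    simp only [I, mem_neighbors_comm (i := k) (j := l)]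
  have hI0 : ∀ k l, 0 ≤ I k l := fun k l => by simp only [I]; split_ifs <;> norm_num
  have e1 : ∑ k, w k * (localMean ε x k - x k) = ∑ k, ∑ l, I k l * (w k / c k * (x l - x k)) := by
    refine Finset.sum_congr rfl fun k _ => ?_
    rw [localMean_sub hε]
    simp only [I, ite_mul, one_mul, zero_mul, Finset.sum_ite_mem, Finset.univ_inter]
    rw [← Finset.mul_sum]
    simp only [hc]; ring
  -- Neighbourhood is symmetric, so adding the two forms of the sum gives a contribution `(w k / c k
  -- - w l / c l) * (x l - x k)` per linked pair.
  have e2 : ∑ k, ∑ l, I k l * (w k / c k * (x l - x k))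
      = ∑ k, ∑ l, I k l * (w l / c l * (x k - x l)) := by
    rw [Finset.sum_comm]
    refine Finset.sum_congr rfl fun k _ => Finset.sum_congr rfl fun l _ => ?_
    rw [hIsymm]
  -- The ratio `2 * n` of consecutive weights beats the ratio of neighbour counts, which is at most
  -- `n`.
  have hpair : ∀ k l, x k < x l → 2 * (w k / c k) ≤ w l / c l := fun k l h => by
    have hs := hlt k l h
    have hpow : (2 * n : ℝ) * w k ≤ w l := by
      simp only [hw]
      rw [← pow_succ']
      exact pow_le_pow_right₀ (by linarith) hs
    have hcl : c l ≤ n := card_neighbors_le x l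
    have h3 : w k / c k ≤ w k := div_le_self (hwpos k).le (hc1 k)
    rw [le_div_iff₀ (hcpos l)]
    calc 2 * (w k / c k) * c l ≤ 2 * w k * n := by
          have := hwpos k; have := hcpos l
          gcongr
      _ = (2 * n : ℝ) * w k := by ring
      _ ≤ w l := hpow
  have hone : ∀ k l, x k < x l → 1 ≤ w l / c l - w k / c k := fun k l h => by
    have h4 : (0:ℝ) < w k / c k := div_pos (hwpos k) (hcpos k)
    have h5 : (2 * n : ℝ) ≤ w l := by
      have hs : 1 ≤ (σ l : ℕ) := by have := hlt k l h; omega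
      calc (2 * n : ℝ) = (2 * n : ℝ) ^ 1 := (pow_one _).symm
        _ ≤ w l := pow_le_pow_right₀ (by linarith) hs
    have h6 : 2 ≤ w l / c l := by
      rw [le_div_iff₀ (hcpos l)]
      have hcl : c l ≤ n := card_neighbors_le x l
      linarith
    linarith [hpair k l h]
  have hterm : ∀ k l, I k l * |x l - x k|
      ≤ -(I k l * ((w k / c k - w l / c l) * (x l - x k))) := fun k l => by
    rw [← mul_neg]
    refine mul_le_mul_of_nonneg_left ?_ (hI0 k l)
    rcases lt_trichotomy (x k) (x l) with h | h | h
    · rw [abs_of_pos (by linarith)]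
      nlinarith [hone k l h]
    · simp [h]
    · rw [abs_of_neg (by linarith)]
      nlinarith [hone l k h]
  have hsum : 2 * ∑ k, w k * (localMean ε x k - x k) ≤ -∑ k, ∑ l, I k l * |x l - x k| := by
    rw [two_mul, e1]
    nth_rewrite 2 [e2]
    rw [← Finset.sum_add_distrib, ← Finset.sum_neg_distrib]
    refine Finset.sum_le_sum fun k _ => ?_
    rw [← Finset.sum_add_distrib, ← Finset.sum_neg_distrib]
    refine Finset.sum_le_sum fun l _ => ?_
    linarith [hterm k l]
  have hlow : 2 * |x j - x i| ≤ ∑ k, ∑ l, I k l * |x l - x k| := by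
    have hnn : ∀ k l, 0 ≤ I k l * |x l - x k| := fun k l => mul_nonneg (hI0 k l) (abs_nonneg _)
    rcases eq_or_ne i j with rfl | hne
    · simpa using Finset.sum_nonneg fun k _ => Finset.sum_nonneg fun l _ => hnn k l
    have hrow : ∀ k l, I k l * |x l - x k| ≤ ∑ l, I k l * |x l - x k| := fun k l =>
      Finset.single_le_sum (f := fun l => I k l * |x l - x k|) (fun l _ => hnn k l)
        (Finset.mem_univ l)
    have hp := Finset.sum_le_sum_of_subset_of_nonneg (Finset.subset_univ {i, j})
      (f := fun k => ∑ l, I k l * |x l - x k|)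
      fun k _ _ => Finset.sum_nonneg fun l _ => hnn k l
    rw [Finset.sum_pair hne] at hp
    have hij1 : I i j = 1 := if_pos hij
    have h7 := hrow i j
    have h8 := hrow j i
    rw [hij1, one_mul] at h7
    rw [hIsymm, hij1, one_mul, abs_sub_comm] at h8
    linarith
  simp only [mul_sub, Finset.sum_sub_distrib] at hsum
  linarith

end Potential

/-! ### Forcing a set by choosing quarters of the noise. -/

section Game

variable {n : ℕ} {ε δ a : ℝ} {S : Finset (Fin n)} {A B U V Y : Set (Fin n → ℝ)}
  {x : Fin n → ℝ}

/-- The four half-intervals into which the noise falls with probability bounded below. -/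
def quarters (a : ℝ) : Set (Set ℝ) :=
  {Set.Ici a, Set.Icc 0 a, Set.Iic (-a), Set.Icc (-a) 0}

/-- From `x`, some quarter is such that all noises in it (and bounded by `δ`) lead into `Y`. -/
def CanForce (ε δ a : ℝ) (S : Finset (Fin n)) (Y : Set (Fin n → ℝ)) (x : Fin n → ℝ) : Prop :=
  ∃ C ∈ quarters a, ∀ w : Fin n → ℝ, (∀ i, w i ∈ C) → (∀ i, |w i| ≤ δ) → step ε S w x ∈ Y

/-- The profiles from which `A` can be forced within `k` steps. -/
def forced (ε δ a : ℝ) (S : Finset (Fin n)) (A : Set (Fin n → ℝ)) : ℕ → Set (Fin n → ℝ)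
  | 0 => A
  | k + 1 => {x | x ∈ A ∨ CanForce ε δ a S (forced ε δ a S A k) x}

/-- `A` can be forced from each profile of `U` within a uniformly bounded number of steps. -/
def LeadsTo (ε δ a : ℝ) (S : Finset (Fin n)) (U A : Set (Fin n → ℝ)) : Prop :=
  ∃ k, U ⊆ forced ε δ a S A k

lemma CanForce.mono (h : CanForce ε δ a S A x) (hAB : A ⊆ B) : CanForce ε δ a S B x := by
  obtain ⟨C, hC, h⟩ := h
  exact ⟨C, hC, fun w h1 h2 => hAB (h w h1 h2)⟩

lemma subset_forced (k : ℕ) : A ⊆ forced ε δ a S A k := by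
  cases k with
  | zero => exact subset_rfl
  | succ k => exact fun x hx => Or.inl hx

lemma forced_mono {k l : ℕ} (h : k ≤ l) : forced ε δ a S A k ⊆ forced ε δ a S A l := by
  induction k generalizing l with
  | zero => exact subset_forced l
  | succ k ih =>
    obtain ⟨l, rfl⟩ := Nat.exists_eq_add_of_lt h
    rintro x (hx | hx)
    · exact Or.inl hx
    · exact Or.inr (hx.mono (ih (by omega)))

lemma forced_subset_forced {k l : ℕ} (h : A ⊆ forced ε δ a S B l) :
    forced ε δ a S A k ⊆ forced ε δ a S B (k + l) := by
  induction k with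
  | zero => rwa [zero_add]
  | succ k ih =>
    rintro x (hx | hx)
    · exact forced_mono (by omega) (h hx)
    · rw [Nat.succ_add]
      exact Or.inr (hx.mono ih)

lemma LeadsTo.of_subset (h : U ⊆ A) : LeadsTo ε δ a S U A := ⟨0, h⟩

lemma LeadsTo.of_canForce (h : ∀ x ∈ U, x ∈ A ∨ CanForce ε δ a S A x) : LeadsTo ε δ a S U A :=
  ⟨1, h⟩

lemma LeadsTo.trans (h : LeadsTo ε δ a S U A) (h' : LeadsTo ε δ a S A B) :
    LeadsTo ε δ a S U B := by
  obtain ⟨k, hk⟩ := h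
  obtain ⟨l, hl⟩ := h'
  exact ⟨k + l, hk.trans (forced_subset_forced hl)⟩

lemma LeadsTo.union (h : LeadsTo ε δ a S U A) (h' : LeadsTo ε δ a S V A) :
    LeadsTo ε δ a S (U ∪ V) A := by
  obtain ⟨k, hk⟩ := h
  obtain ⟨l, hl⟩ := h'
  exact ⟨max k l, Set.union_subset (hk.trans (forced_mono (le_max_left k l)))
    (hl.trans (forced_mono (le_max_right k l)))⟩

/-- A bounded function that can be lowered by a constant as long as `A` is not reached. -/
lemma LeadsTo.of_descent {φ : (Fin n → ℝ) → ℝ} {M c : ℝ} (hc : 0 < c)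
    (hM : ∀ x ∈ U, |φ x| ≤ M)
    (h : ∀ x ∈ U, x ∈ A ∨ CanForce ε δ a S (A ∪ {y ∈ U | φ y ≤ φ x - c}) x) :
    LeadsTo ε δ a S U A := by
  have key : ∀ k : ℕ, {x ∈ U | φ x < -M + k * c} ⊆ forced ε δ a S A k := by
    intro k
    induction k with
    | zero =>
      rintro x ⟨hx, hlt⟩
      have := (abs_le.1 (hM x hx)).1
      simp only [Nat.cast_zero, zero_mul] at hlt
      linarith
    | succ k ih =>
      rintro x ⟨hx, hlt⟩
      refine (h x hx).imp id fun hf => hf.mono (Set.union_subset (subset_forced k) ?_)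
      rintro y ⟨hy, hle⟩
      refine ih ⟨hy, ?_⟩
      push_cast at hlt
      linarith
  obtain ⟨k, hk⟩ := exists_nat_gt (2 * M / c)
  refine ⟨k, fun x hx => key k ⟨hx, ?_⟩⟩
  rw [div_lt_iff₀ hc] at hk
  linarith [(abs_le.1 (hM x hx)).2]

end Game

/-! ### One step inside the cube. -/

section Step

variable {n : ℕ} {ε δ a : ℝ} {S : Finset (Fin n)} {x w : Fin n → ℝ} {i : Fin n}

/-- The profiles with all opinions in `[0, 1]`. -/
def cube (n : ℕ) : Set (Fin n → ℝ) := {x | ∀ i, x i ∈ Set.Icc (0 : ℝ) 1}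

lemma step_mem_cube (ε : ℝ) (S : Finset (Fin n)) (w x : Fin n → ℝ) : step ε S w x ∈ cube n :=
  fun _ => clip_mem _

lemma localMean_mem (hε : 0 ≤ ε) (hx : x ∈ cube n) (i : Fin n) :
    localMean ε x i ∈ Set.Icc (0 : ℝ) 1 :=
  ⟨le_localMean hε fun j _ => (hx j).1, localMean_le hε fun j _ => (hx j).2⟩

lemma localMean_le_step (hε : 0 ≤ ε) (hx : x ∈ cube n) (hw : ∀ i, 0 ≤ w i) (i : Fin n) :
    localMean ε x i ≤ step ε S w x i := by
  rw [← clip_of_mem (localMean_mem hε hx i), step]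
  refine clip_mono ?_
  have := hw i
  split_ifs <;> linarith

lemma step_le_localMean (hε : 0 ≤ ε) (hx : x ∈ cube n) (hw : ∀ i, w i ≤ 0) (i : Fin n) :
    step ε S w x i ≤ localMean ε x i := by
  rw [← clip_of_mem (localMean_mem hε hx i), step]
  refine clip_mono ?_
  have := hw i
  split_ifs <;> linarith

lemma step_of_notMem (hε : 0 ≤ ε) (hx : x ∈ cube n) (hi : i ∉ S) :
    step ε S w x i = localMean ε x i := by
  rw [step, if_neg hi, add_zero, clip_of_mem (localMean_mem hε hx i)]

lemma step_of_mem (hi : i ∈ S) : step ε S w x i = clip (localMean ε x i + w i) := by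
  rw [step, if_pos hi]

lemma step_eq_add (hε : 0 ≤ ε) (hx : x ∈ cube n) (hi : i ∈ S) (hw : w i ≤ 0)
    (h0 : 0 ≤ localMean ε x i + w i) : step ε S w x i = localMean ε x i + w i := by
  rw [step_of_mem hi, clip_of_mem ⟨h0, by linarith [(localMean_mem hε hx i).2]⟩]

lemma canForce_of_nonneg {Y : Set (Fin n → ℝ)}
    (h : ∀ w : Fin n → ℝ, (∀ i, 0 ≤ w i) → step ε S w x ∈ Y) : CanForce ε δ a S Y x :=
  ⟨Set.Icc 0 a, by simp [quarters], fun w hw _ => h w fun i => (hw i).1⟩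

end Step

/-! ### Entering the window and raising the lower bound. -/

section Moves

variable {n : ℕ} {ε δ a c v : ℝ} {S : Finset (Fin n)} {x : Fin n → ℝ} {i : Fin n}

/-- Relations between the confidence threshold `ε`, the noise bound `δ`, the noise level `a` and
a small margin `c`. -/
structure Margins (n : ℕ) (ε δ a c : ℝ) : Prop where
  eps_pos : 0 < ε
  delta_le : δ ≤ ε
  c_pos : 0 < c
  c_le_div : c ≤ ε / n
  c_le_a : c ≤ a
  two_c_le : 2 * c ≤ ε
  c_le_sub : c ≤ ε - a

/-- The profiles with all pairs of opinions within `ε`. -/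
def agreement (n : ℕ) (ε : ℝ) : Set (Fin n → ℝ) := {x | ∀ i j, |x i - x j| ≤ ε}

/-- The profiles with all opinions in `[v, 1]`. -/
def above (n : ℕ) (v : ℝ) : Set (Fin n → ℝ) := {x ∈ cube n | ∀ i, v ≤ x i}

/-- The profiles bounded below by some `u ≥ v` in which some opinion is in `[u + c, u + ε]`. -/
def windowed (n : ℕ) (ε c v : ℝ) : Set (Fin n → ℝ) :=
  {x ∈ cube n | ∃ u, v ≤ u ∧ (∀ i, u ≤ x i) ∧ ∃ j, u + c ≤ x j ∧ x j ≤ u + ε}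

/-- The profiles in which neighbours are within `c`. -/
def tight (n : ℕ) (ε c : ℝ) : Set (Fin n → ℝ) :=
  {x | ∀ i j, |x i - x j| ≤ ε → |x i - x j| ≤ c}

/-- The profiles that count as progress beyond the lower bound `v`. -/
def progress (n : ℕ) (ε c v : ℝ) : Set (Fin n → ℝ) :=
  agreement n ε ∪ above n (v + c / n) ∪ windowed n ε c v

lemma progress_of_agreement (h : x ∈ agreement n ε) : x ∈ progress n ε c v :=
  Or.inl (Or.inl h)

lemma windowed_subset_progress : windowed n ε c v ⊆ progress n ε c v :=
  fun _ => Or.inr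

lemma step_mem_above (hε : 0 ≤ ε) (hx : x ∈ above n v) {w : Fin n → ℝ} (hw : ∀ i, 0 ≤ w i) :
    step ε S w x ∈ above n v :=
  ⟨step_mem_cube ε S w x, fun i =>
    (le_localMean hε fun j _ => hx.2 j).trans (localMean_le_step hε hx.1 hw i)⟩

/-- An agent below `u + c` sees the window opinion, and any other agent counts itself; either way
some neighbour exceeds `u` by `c`. -/
lemma canForce_above_of_windowed (hm : Margins n ε δ a c) (hx : x ∈ windowed n ε c v) :
    CanForce ε δ a S (above n (v + c / n)) x := by
  obtain ⟨hx, u, huv, hu, j, hj1, hj2⟩ := hx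
  have hε := hm.eps_pos.le
  have hc := hm.c_pos
  refine canForce_of_nonneg fun w hw => ⟨step_mem_cube ε S w x, fun i => ?_⟩
  refine le_trans ?_ (localMean_le_step hε hx hw i)
  have : u + c / n ≤ localMean ε x i := by
    by_cases hi : u + c ≤ x i
    · exact add_div_le_localMean hε hc.le (fun j _ => hu j) (self_mem_neighbors hε x i) hi
    · refine add_div_le_localMean hε hc.le (fun j _ => hu j) (k := j) ?_ hj1
      rw [mem_neighbors, abs_le]
      constructor <;> linarith [hu i]
  linarith

/-- A noiseless agent with neighbours on both sides of the window enters it. -/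
lemma canForce_windowed_of_bridge (hm : Margins n ε δ a c) (hx : x ∈ above n v) (hi : i ∉ S)
    (hN : ∀ j ∈ neighbors ε x i, x j ≤ v + c + ε)
    (hlow : ∃ j ∈ neighbors ε x i, x j < v + c) (hhigh : ∃ j ∈ neighbors ε x i, v + ε < x j) :
    CanForce ε δ a S (windowed n ε c v) x := by
  obtain ⟨p, hp, hpv⟩ := hlow
  obtain ⟨q, hq, hqv⟩ := hhigh
  have hε := hm.eps_pos.le
  have hc := hm.c_le_div
  refine canForce_of_nonneg fun w hw => ?_
  refine ⟨step_mem_cube ε S w x, v, le_rfl, (step_mem_above hε hx hw).2, i, ?_⟩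
  rw [step_of_notMem hε hx.1 hi]
  -- `q` keeps the mean `ε / n` above `v`, and `p` keeps it `ε / n` below `v + c + ε`; both suffice
  -- as `c ≤ ε / n`.
  have h1 := add_div_le_localMean hε hε (fun j _ => hx.2 j) hq hqv.le
  have h2 := localMean_le_sub_div hε hε hN hp (by linarith)
  constructor <;> linarith

/-- If the agents below the window are separated from those above it and one of them is noisy,
a push to the right brings an agent into the window. -/
lemma canForce_windowed_of_isolated (hm : Margins n ε δ a c) (hv : 0 ≤ v) (hx : x ∈ above n v)
    (hi : i ∈ S) (hiv : x i < v + c) (hcover : ∀ j, x j < v + c ∨ v + ε < x j)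
    (hsep : ∀ j k, x j < v + c → v + ε < x k → ε < |x k - x j|) :
    x ∈ agreement n ε ∨ CanForce ε δ a S (windowed n ε c v) x := by
  have hε := hm.eps_pos.le
  have h1 := hm.c_le_a
  have h2 := hm.c_pos
  have h3 := hm.two_c_le
  have h4 := hm.c_le_sub
  have h5 := hm.delta_le
  by_cases hR : ∃ k, v + ε < x k
  swap
  · left
    push Not at hR
    have hL : ∀ j, x j < v + c := fun j => (hcover j).resolve_right (not_lt.2 (hR j))
    intro j k
    rw [abs_le]
    constructor <;> linarith [hL j, hL k, hx.2 j, hx.2 k]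
  right
  obtain ⟨r, hr⟩ := hR
  -- An agent beyond the window shows `v + ε < 1`, so truncation at 1 cannot spoil the push.
  have hr1 := (hx.1 r).2
  set μ := localMean ε x i with hμ
  have hNL : ∀ j, x j < v + c → neighbors ε x j = Finset.univ.filter fun k => x k < v + c := by
    intro j hj
    ext k
    rw [mem_neighbors, Finset.mem_filter]
    constructor
    · intro hk
      refine ⟨Finset.mem_univ k, (hcover k).resolve_right fun hkv => ?_⟩
      exact absurd hk (not_le.2 (hsep j k hj hkv))
    · rintro ⟨-, hk⟩
      rw [abs_le]
      constructor <;> linarith [hx.2 j, hx.2 k]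
  have hLmean : ∀ j, x j < v + c → localMean ε x j = μ := fun j hj => by
    rw [hμ, localMean, localMean, hNL j hj, hNL i hiv]
  have hμv : v ≤ μ := le_localMean hε fun j _ => hx.2 j
  have hμc : μ < v + c := localMean_lt hε fun j hj => by
    rw [hNL i hiv] at hj
    exact (Finset.mem_filter.1 hj).2
  have hRmean : ∀ j, v + ε < x j → v + ε < localMean ε x j := fun j hj =>
    lt_localMean hε fun k hk => (hcover k).resolve_left fun hkv => by
      rw [mem_neighbors, abs_sub_comm] at hk
      exact absurd hk (not_le.2 (hsep k j hkv hj))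
  refine ⟨Set.Ici a, by simp [quarters], fun w hw hwδ => ?_⟩
  have hw0 : ∀ j, 0 ≤ w j := fun j => by have : a ≤ w j := hw j; linarith
  -- The window now starts from the common mean `μ` of the low cluster: a push between `a` and `δ`
  -- lands in `[μ + c, μ + ε]`.
  refine ⟨step_mem_cube ε S w x, μ, hμv, fun j => ?_, i, ?_, ?_⟩
  · have := localMean_le_step hε hx.1 hw0 (S := S) j
    rcases hcover j with hj | hj
    · exact (hLmean j hj).ge.trans this
    · linarith [hRmean j hj]
  · have : a ≤ w i := hw i
    rw [step_of_mem hi, clip_eq]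
    exact le_min (by linarith) (le_max_of_le_right (by linarith))
  · rw [step_of_mem hi, clip_eq]
    refine (min_le_right _ _).trans (max_le (by linarith) ?_)
    linarith [(abs_le.1 (hwδ i)).2]

end Moves

/-! ### The controller's strategy. -/

section Strategy

variable {n : ℕ} {ε δ a c v : ℝ} {S : Finset (Fin n)} {x : Fin n → ℝ}

/-- The profiles above `v` with all noisy agents beyond the window. -/
def fetching (n : ℕ) (ε v : ℝ) (S : Finset (Fin n)) : Set (Fin n → ℝ) :=
  {x ∈ above n v | ∀ i ∈ S, v + ε < x i}

/-- The profiles above `v` in which a single noisy agent has jumped over the window, away from a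
cluster at `ρ` that is separated from everything to its right. -/
def overshot (n : ℕ) (ε c v : ℝ) (S : Finset (Fin n)) : Set (Fin n → ℝ) :=
  {x ∈ above n v | ∃ i, S = {i} ∧ x i < v + c ∧ ∃ ρ, v + ε < ρ ∧ ρ ≤ v + c + ε ∧
    ∀ j, j ≠ i → x j < v + c ∨ x j = ρ ∨ ρ + ε < x j}

lemma leadsTo_tight (hm : Margins n ε δ a c) :
    LeadsTo ε δ a S (above n v) (above n v ∩ tight n ε c) := by
  have hε := hm.eps_pos.le
  refine LeadsTo.of_descent (φ := fun x => potential (-x)) hm.c_pos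
    (fun x hx => abs_potential_le fun i => ?_) fun x hx => ?_
  · rw [Pi.neg_apply, abs_neg, abs_of_nonneg (hx.1 i).1]
    exact (hx.1 i).2
  by_cases ht : x ∈ tight n ε c
  · exact Or.inl ⟨hx, ht⟩
  right
  simp only [tight, Set.mem_ofPred_eq, not_forall, not_le] at ht
  obtain ⟨i, j, hij, hcij⟩ := ht
  refine canForce_of_nonneg fun w hw => Or.inr ⟨step_mem_above hε hx hw, ?_⟩
  have h1 : potential (-step ε S w x) ≤ potential (localMean ε (-x)) := by
    rw [localMean_neg]
    exact potential_mono (neg_le_neg (localMean_le_step hε hx.1 hw))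
  have h2 := potential_localMean_le (x := -x) hε (i := i) (j := j)
    (by rwa [mem_neighbors, Pi.neg_apply, Pi.neg_apply, neg_sub_neg])
  rw [Pi.neg_apply, Pi.neg_apply, neg_sub_neg] at h2
  linarith

/-- Noisy means exceed `v + ε` and `δ ≤ ε`, so pulling left preserves the bound `v`. In a tight
profile a strong pull lowers the potential by itself. Otherwise averaging does, and noise in `[-a,
0]` cannot jump over the window because `c ≤ ε - a`. -/
lemma fetching_step (hm : Margins n ε δ a c) (hv : 0 ≤ v) (hS : S.Nonempty)
    (hSδ : (∃ i, S = {i}) ∨ δ ≤ ε / 2) (hx : x ∈ fetching n ε v S) :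
    x ∈ progress n ε c v ∪ overshot n ε c v S ∨
    CanForce ε δ a S (progress n ε c v ∪ overshot n ε c v S ∪
      {y ∈ fetching n ε v S | potential y ≤ potential x - c}) x := by
  obtain ⟨hx, hxS⟩ := hx
  have hε := hm.eps_pos.le
  have h1 := hm.c_le_a
  have h2 := hm.c_pos
  have h3 := hm.two_c_le
  have h4 := hm.c_le_sub
  have h5 := hm.delta_le
  by_cases hwin : ∃ j, v + c ≤ x j ∧ x j ≤ v + ε
  · exact Or.inl (Or.inl (windowed_subset_progress ⟨hx.1, v, le_rfl, hx.2, hwin⟩))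
  right
  have hcover : ∀ j, x j < v + c ∨ v + ε < x j := fun j => by
    by_contra! hc
    exact hwin ⟨j, hc⟩
  by_cases hbr : ∃ l r, x l < v + c ∧ v + ε < x r ∧ |x r - x l| ≤ ε
  · obtain ⟨l, r, hl, hr, hlr⟩ := hbr
    refine (canForce_windowed_of_bridge hm hx (i := l) (fun hlS => ?_) (fun j hj => ?_)
      ⟨l, self_mem_neighbors hε x l, hl⟩ ⟨r, mem_neighbors.2 hlr, hr⟩).mono fun y hy =>
        Or.inl (Or.inl (windowed_subset_progress hy))
    · linarith [hxS l hlS]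
    · linarith [(abs_le.1 (mem_neighbors.1 hj)).2]
  push Not at hbr
  have hLmean : ∀ j, x j < v + c → localMean ε x j < v + c := fun j hj =>
    localMean_lt hε fun k hk => (hcover k).resolve_right fun hkv =>
      absurd (mem_neighbors.1 hk) (not_le.2 (hbr j k hj hkv))
  have hRmean : ∀ j, v + ε < x j → v + ε < localMean ε x j := fun j hj =>
    lt_localMean hε fun k hk => (hcover k).resolve_left fun hkv =>
      absurd (mem_neighbors.1 (mem_neighbors_comm.1 hk)) (not_le.2 (hbr k j hkv hj))
  have hvmean : ∀ j, v ≤ localMean ε x j := fun j => le_localMean hε fun k _ => hx.2 k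
  have hnoisy : ∀ w : Fin n → ℝ, (∀ i, w i ≤ 0) → (∀ i, |w i| ≤ δ) → ∀ i ∈ S,
      step ε S w x i = localMean ε x i + w i := fun w hw hwδ i hi =>
    step_eq_add hε hx.1 hi (hw i)
      (by linarith [hRmean i (hxS i hi), (abs_le.1 (hwδ i)).1])
  have habove : ∀ w : Fin n → ℝ, (∀ i, w i ≤ 0) → (∀ i, |w i| ≤ δ) →
      step ε S w x ∈ above n v := fun w hw hwδ => by
    refine ⟨step_mem_cube ε S w x, fun i => ?_⟩
    by_cases hi : i ∈ S
    · rw [hnoisy w hw hwδ i hi]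
      linarith [hRmean i (hxS i hi), (abs_le.1 (hwδ i)).1]
    · rw [step_of_notMem hε hx.1 hi]
      exact hvmean i
  by_cases ht : x ∈ tight n ε c
  · refine ⟨Set.Iic (-a), by simp [quarters], fun w hw hwδ => ?_⟩
    have hwa : ∀ i, w i ≤ -a := hw
    have hw0 : ∀ i, w i ≤ 0 := fun i => by linarith [hwa i]
    have hy := habove w hw0 hwδ
    by_cases hyS : ∀ i ∈ S, v + ε < step ε S w x i
    · refine Or.inr ⟨⟨hy, hyS⟩, ?_⟩
      obtain ⟨i, hi⟩ := hS
      have e1 := potential_le_sub (a := a) (by linarith) (step_le_localMean hε hx.1 hw0 (S := S)) i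
        (by rw [hnoisy w hw0 hwδ i hi]; linarith [hwa i])
      have e2 := potential_localMean_le (x := x) hε (self_mem_neighbors hε x i)
      rw [sub_self, abs_zero] at e2
      linarith
    · left
      push Not at hyS
      obtain ⟨i, hi, hyi⟩ := hyS
      by_cases hic : v + c ≤ step ε S w x i
      · exact Or.inl (windowed_subset_progress ⟨hy.1, v, le_rfl, hy.2, i, hic, hyi⟩)
      right
      have hyw := hnoisy w hw0 hwδ i hi
      have hiR := hRmean i (hxS i hi)
      have hwi := (abs_le.1 (hwδ i)).1
      push Not at hic
      -- Jumping over the window takes noise larger than `ε - c ≥ ε / 2`.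
      have hSi : S = {i} := by
        rcases hSδ with ⟨k, rfl⟩ | hδ
        · rw [Finset.mem_singleton.1 hi]
        · linarith
      -- `ρ` is the mean of `i` without noise: by tightness the neighbours of `i` have the same
      -- neighbourhood and all move exactly there.
      refine ⟨hy, i, hSi, hic, localMean ε x i, hiR, by linarith, fun j hj => ?_⟩
      have hjS : j ∉ S := by rwa [hSi, Finset.mem_singleton]
      rw [step_of_notMem hε hx.1 hjS]
      rcases hcover j with hjv | hjv
      · exact Or.inl (hLmean j hjv)
      right
      by_cases hji : |x j - x i| ≤ ε
      · left
        have hNN : neighbors ε x j = neighbors ε x i := by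
          ext k
          have hji' := abs_le.1 (ht j i hji)
          rw [mem_neighbors, mem_neighbors]
          constructor <;> intro hk <;>
          · have := abs_le.1 (ht _ _ hk)
            rw [abs_le]
            constructor <;> linarith
        rw [localMean, localMean, hNN]
      · right
        have hxi : x i - c ≤ localMean ε x i := le_localMean hε fun k hk => by
          linarith [(abs_le.1 (ht k i (mem_neighbors.1 hk))).1]
        have hlt : x i + ε < x j := by
          rw [abs_le] at hji
          by_contra hc
          exact hji ⟨by linarith, by linarith⟩
        -- Were `k` not beyond `x q + ε`, tightness would put `k` within `c` of `i`, hence `j`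
        -- within `2 * c ≤ ε` of `i`.
        have hfar : ∀ k ∈ neighbors ε x j, ∀ q ∈ neighbors ε x i, x q + ε < x k := by
          intro k hk q hq
          have hk' := abs_le.1 (ht k j (mem_neighbors.1 hk))
          have hq' := abs_le.1 (ht q i (mem_neighbors.1 hq))
          by_contra hc
          have hkq := abs_le.1 (ht k q (abs_le.2 ⟨by linarith, by linarith⟩))
          have hki := abs_le.1 (ht k i (abs_le.2 ⟨by linarith, by linarith⟩))
          linarith
        have := localMean_lt (x := x) (i := i) (b := localMean ε x j - ε) hε fun q hq => by
          linarith [lt_localMean (x := x) (i := j) hε fun k hk => hfar k hk q hq]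
        linarith
  · simp only [tight, Set.mem_ofPred_eq, not_forall, not_le] at ht
    obtain ⟨k, l, hkl, hckl⟩ := ht
    refine ⟨Set.Icc (-a) 0, by simp [quarters], fun w hw hwδ => ?_⟩
    have hw0 : ∀ i, w i ≤ 0 := fun i => (hw i).2
    have hy := habove w hw0 hwδ
    by_cases hyS : ∀ i ∈ S, v + ε < step ε S w x i
    · refine Or.inr ⟨⟨hy, hyS⟩, ?_⟩
      have e1 := potential_mono (step_le_localMean hε hx.1 hw0 (S := S))
      have e2 := potential_localMean_le hε (mem_neighbors.2 hkl)
      linarith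
    · push Not at hyS
      obtain ⟨i, hi, hyi⟩ := hyS
      refine Or.inl (Or.inl (windowed_subset_progress ⟨hy.1, v, le_rfl, hy.2, i, ?_, hyi⟩))
      rw [hnoisy w hw0 hwδ i hi]
      linarith [hRmean i (hxS i hi), (hw i).1]

lemma fetching_leadsTo (hm : Margins n ε δ a c) (hv : 0 ≤ v) (hS : S.Nonempty)
    (hSδ : (∃ i, S = {i}) ∨ δ ≤ ε / 2) :
    LeadsTo ε δ a S (fetching n ε v S) (progress n ε c v ∪ overshot n ε c v S) := by
  refine LeadsTo.of_descent hm.c_pos (fun x hx => abs_potential_le fun i => ?_)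
    fun x hx => fetching_step hm hv hS hSδ hx
  rw [abs_of_nonneg (hx.1.1 i).1]
  exact (hx.1.1 i).2

/-- If the two sides are linked, a noiseless agent bridges them: a low agent other than `i`, or one
at `ρ`, which sees nothing above `ρ`. If not, `i` is a noisy agent in an isolated low cluster. -/
lemma overshot_step (hm : Margins n ε δ a c) (hv : 0 ≤ v) (hx : x ∈ overshot n ε c v S) :
    x ∈ agreement n ε ∨ CanForce ε δ a S (windowed n ε c v) x := by
  obtain ⟨hx, i, rfl, hi, ρ, hρ, hρc, hall⟩ := hx
  have hε := hm.eps_pos.le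
  have h2 := hm.c_pos
  have h3 := hm.two_c_le
  have hcover : ∀ j, x j < v + c ∨ v + ε < x j := fun j => by
    by_cases hj : j = i
    · exact Or.inl (hj ▸ hi)
    · rcases hall j hj with h | h | h
      · exact Or.inl h
      · exact Or.inr (h ▸ hρ)
      · exact Or.inr (by linarith)
  by_cases hbr : ∃ l r, x l < v + c ∧ v + ε < x r ∧ |x r - x l| ≤ ε
  · right
    obtain ⟨l, r, hl, hr, hlr⟩ := hbr
    by_cases hli : l = i
    · subst hli
      have hrl : r ≠ l := by rintro rfl; linarith
      have hrρ : x r = ρ := by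
        rcases hall r hrl with h | h | h
        · linarith
        · exact h
        · linarith [(abs_le.1 hlr).2]
      refine canForce_windowed_of_bridge hm hx (i := r) (by simpa using hrl) (fun j hj => ?_)
        ⟨l, mem_neighbors_comm.1 (mem_neighbors.2 hlr), hl⟩ ⟨r, self_mem_neighbors hε x r, hr⟩
      by_cases hjl : j = l
      · subst hjl; linarith
      · rcases hall j hjl with h | h | h
        · linarith
        · linarith
        · linarith [(abs_le.1 (mem_neighbors.1 hj)).2]
    · refine canForce_windowed_of_bridge hm hx (i := l) (by simpa using hli) (fun j hj => ?_)
        ⟨l, self_mem_neighbors hε x l, hl⟩ ⟨r, mem_neighbors.2 hlr, hr⟩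
      linarith [(abs_le.1 (mem_neighbors.1 hj)).2]
  · push Not at hbr
    exact canForce_windowed_of_isolated hm hv hx (Finset.mem_singleton_self i) hi hcover hbr

lemma above_leadsTo (hm : Margins n ε δ a c) (hv : 0 ≤ v) (hS : S.Nonempty)
    (hSδ : (∃ i, S = {i}) ∨ δ ≤ ε / 2) :
    LeadsTo ε δ a S (above n v) (agreement n ε ∪ above n (v + c / n)) := by
  have hε := hm.eps_pos.le
  have h2 := hm.c_pos
  have h3 := hm.two_c_le
  have htight : LeadsTo ε δ a S (above n v ∩ tight n ε c)
      (progress n ε c v ∪ fetching n ε v S) := by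
    refine LeadsTo.of_canForce fun x ⟨hx, ht⟩ => ?_
    by_cases hwin : ∃ j, v + c ≤ x j ∧ x j ≤ v + ε
    · exact Or.inl (Or.inl (windowed_subset_progress ⟨hx.1, v, le_rfl, hx.2, hwin⟩))
    have hcover : ∀ j, x j < v + c ∨ v + ε < x j := fun j => by
      by_contra! hc
      exact hwin ⟨j, hc⟩
    by_cases hSL : ∃ i ∈ S, x i < v + c
    · obtain ⟨i, hi, hiv⟩ := hSL
      refine (canForce_windowed_of_isolated hm hv hx hi hiv hcover fun j k hj hk => ?_).imp
        (fun h => Or.inl (progress_of_agreement h))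
        fun h => h.mono fun y hy => Or.inl (windowed_subset_progress hy)
      by_contra! hc
      linarith [(abs_le.1 (ht k j hc)).2]
    · push Not at hSL
      exact Or.inl (Or.inr ⟨hx, fun i hi => (hcover i).resolve_left (not_lt.2 (hSL i hi))⟩)
  have hover : LeadsTo ε δ a S (overshot n ε c v S) (progress n ε c v) :=
    LeadsTo.of_canForce fun x hx => (overshot_step hm hv hx).imp progress_of_agreement
      fun h => h.mono windowed_subset_progress
  have hprog : LeadsTo ε δ a S (progress n ε c v) (agreement n ε ∪ above n (v + c / n)) :=
    (LeadsTo.of_subset subset_rfl).union <| LeadsTo.of_canForce fun x hx =>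
      Or.inr ((canForce_above_of_windowed hm hx).mono Set.subset_union_right)
  have hfetch := (fetching_leadsTo hm hv hS hSδ).trans
    ((LeadsTo.of_subset subset_rfl).union hover)
  exact (leadsTo_tight hm).trans
    ((htight.trans ((LeadsTo.of_subset subset_rfl).union hfetch)).trans hprog)

/-- Agreement can be forced from every profile within a bounded number of steps. -/
theorem cube_leadsTo_agreement (hm : Margins n ε δ a c) (hS : S.Nonempty)
    (hSδ : (∃ i, S = {i}) ∨ δ ≤ ε / 2) :
    LeadsTo ε δ a S (cube n) (agreement n ε) := by
  obtain ⟨i₀, -⟩ := id hS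
  have hn : (0 : ℝ) < n := by exact_mod_cast i₀.pos
  have hc : 0 < c / n := div_pos hm.c_pos hn
  have key : ∀ k : ℕ, LeadsTo ε δ a S (above n (1 - k * (c / n))) (agreement n ε) := by
    intro k
    induction k with
    | zero =>
      refine LeadsTo.of_subset fun x hx i j => ?_
      have hone : ∀ i, x i = 1 := fun i => le_antisymm (hx.1 i).2 (by simpa using hx.2 i)
      rw [hone, hone, sub_self, abs_zero]
      exact hm.eps_pos.le
    | succ k ih =>
      -- Clamping at 0 is harmless in the cube and supplies the condition `0 ≤ v`.
      have hsub : above n (1 - (k + 1 : ℕ) * (c / n))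
          ⊆ above n (max 0 (1 - (k + 1 : ℕ) * (c / n))) :=
        fun x hx => ⟨hx.1, fun i => max_le (hx.1 i).1 (hx.2 i)⟩
      have hup : above n (max 0 (1 - (k + 1 : ℕ) * (c / n)) + c / n)
          ⊆ above n (1 - k * (c / n)) := fun x hx => ⟨hx.1, fun i => by
        have := le_max_right (0 : ℝ) (1 - (k + 1 : ℕ) * (c / n))
        push_cast at this hx
        linarith [hx.2 i]⟩
      exact (LeadsTo.of_subset hsub).trans
        ((above_leadsTo hm (le_max_left _ _) hS hSδ).trans
          ((LeadsTo.of_subset subset_rfl).union ((LeadsTo.of_subset hup).trans ih)))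
  obtain ⟨k, hk⟩ := exists_nat_ge (1 / (c / n))
  rw [div_le_iff₀ hc] at hk
  have hsub : cube n ⊆ above n (1 - k * (c / n)) :=
    fun x hx => ⟨hx, fun i => by linarith [(hx i).1]⟩
  exact (LeadsTo.of_subset hsub).trans (key k)

end Strategy

/-! ### Agreement is absorbing. -/

section Absorption

variable {n : ℕ} {ε δ : ℝ} {S : Finset (Fin n)} {x w : Fin n → ℝ}

lemma abs_step_sub_step_le (hx : x ∈ agreement n ε) (i j : Fin n) :
    |step ε S w x i - step ε S w x j|
      ≤ |(if i ∈ S then w i else 0) - (if j ∈ S then w j else 0)| := by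
  have hN : ∀ i, neighbors ε x i = Finset.univ := fun i => by
    ext k
    simpa [mem_neighbors] using hx k i
  have hmean : localMean ε x i = localMean ε x j := by rw [localMean, localMean, hN, hN]
  refine (abs_clip_sub_clip_le _ _).trans_eq ?_
  rw [hmean, add_sub_add_left_eq_sub]

lemma abs_step_sub_step_le_of_card_eq_one (hx : x ∈ agreement n ε) (hδ : 0 ≤ δ)
    (hw : ∀ i, |w i| ≤ δ) (hS : S.card = 1) (i j : Fin n) :
    |step ε S w x i - step ε S w x j| ≤ δ := by
  obtain ⟨s, rfl⟩ := Finset.card_eq_one.1 hS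
  refine (abs_step_sub_step_le hx i j).trans ?_
  simp only [Finset.mem_singleton]
  split_ifs with h1 h2 h2
  · simpa [h1, h2] using hδ
  · simpa using hw i
  · simpa using hw j
  · simpa using hδ

lemma abs_step_sub_step_le_two_mul (hx : x ∈ agreement n ε) (hδ : 0 ≤ δ)
    (hw : ∀ i, |w i| ≤ δ) (i j : Fin n) :
    |step ε S w x i - step ε S w x j| ≤ 2 * δ := by
  have h : ∀ i, |if i ∈ S then w i else 0| ≤ δ := fun i => by
    split_ifs
    · exact hw i
    · simpa using hδ
  refine (abs_step_sub_step_le hx i j).trans ((abs_sub _ _).trans ?_)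
  linarith [h i, h j]

lemma step_mem_agreement (hδ : 0 ≤ δ) (hS : S.Nonempty) (hδ_one : S.card = 1 → δ ≤ ε)
    (hδ_many : 1 < S.card → δ ≤ ε / 2) (hw : ∀ i, |w i| ≤ δ) (hx : x ∈ agreement n ε) :
    step ε S w x ∈ agreement n ε := by
  intro i j
  rcases (Nat.succ_le_of_lt hS.card_pos).eq_or_lt with h | h
  · exact (abs_step_sub_step_le_of_card_eq_one hx hδ hw h.symm i j).trans (hδ_one h.symm)
  · linarith [abs_step_sub_step_le_two_mul (S := S) hx hδ hw i j, hδ_many h]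

end Absorption

/-! ### Measurability of the dynamics. -/

section Measurability

variable {n : ℕ}

lemma measurable_localMean (ε : ℝ) (i : Fin n) :
    Measurable fun x : Fin n → ℝ => localMean ε x i := by
  have h : (fun x : Fin n → ℝ => localMean ε x i) = fun x =>
      (∑ j, if |x j - x i| ≤ ε then (1 : ℝ) else 0)⁻¹ * ∑ j, if |x j - x i| ≤ ε then x j else 0 := by
    ext x
    simp [localMean, neighbors, Finset.sum_filter]
  have hs : ∀ j, MeasurableSet {x : Fin n → ℝ | |x j - x i| ≤ ε} := fun j =>
    measurableSet_le (by fun_prop) measurable_const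
  rw [h]
  refine (Finset.measurable_sum _ fun j _ => ?_).inv.mul (Finset.measurable_sum _ fun j _ => ?_)
  · exact Measurable.ite (hs j) measurable_const measurable_const
  · exact Measurable.ite (hs j) (measurable_pi_apply j) measurable_const

lemma measurable_step (ε : ℝ) (S : Finset (Fin n)) :
    Measurable fun q : (Fin n → ℝ) × (Fin n → ℝ) => step ε S q.2 q.1 := by
  refine measurable_pi_lambda _ fun i => ?_
  simp only [step]
  refine measurable_clip.comp (((measurable_localMean ε i).comp measurable_fst).add ?_)
  split_ifs
  · exact (measurable_pi_apply i).comp measurable_snd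
  · exact measurable_const

lemma measurableSet_agreement (n : ℕ) (ε : ℝ) : MeasurableSet (agreement n ε) := by
  have : agreement n ε = ⋂ i, ⋂ j, {x | |x i - x j| ≤ ε} := by
    ext x; simp [agreement]
  rw [this]
  exact MeasurableSet.iInter fun i => MeasurableSet.iInter fun j =>
    measurableSet_le (by fun_prop) measurable_const

end Measurability

/-! ### From forcing to almost sure absorption. -/

section Chain

open scoped ENNReal

variable {n : ℕ} {ε δ a : ℝ} {S : Finset (Fin n)} {A : Set (Fin n → ℝ)}
  {ν : ℕ → Measure (Fin n → ℝ)} {q : ℝ≥0∞}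

/-- The probability that the chain with noise laws `ν` is in `A` after `k` steps, when it is at `x`
at time `t`. -/
noncomputable def success (ε : ℝ) (S : Finset (Fin n)) (A : Set (Fin n → ℝ))
    (ν : ℕ → Measure (Fin n → ℝ)) : ℕ → ℕ → (Fin n → ℝ) → ℝ≥0∞
  | 0, _, x => A.indicator 1 x
  | k + 1, t, x => ∫⁻ w, success ε S A ν k (t + 1) (step ε S w x) ∂ν t

lemma measurable_success [∀ t, IsProbabilityMeasure (ν t)] (hA : MeasurableSet A) (k t : ℕ) :
    Measurable (success ε S A ν k t) := by
  induction k generalizing t with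
  | zero => exact measurable_one.indicator hA
  | succ k ih => exact ((ih (t + 1)).comp (measurable_step ε S)).lintegral_prod_right'

lemma success_of_mem [∀ t, IsProbabilityMeasure (ν t)]
    (habs : ∀ x ∈ A, ∀ w : Fin n → ℝ, (∀ i, |w i| ≤ δ) → step ε S w x ∈ A)
    (hν : ∀ t, ∀ᵐ w ∂ν t, ∀ i, |w i| ≤ δ) (k t : ℕ) {x : Fin n → ℝ} (hx : x ∈ A) :
    success ε S A ν k t x = 1 := by
  induction k generalizing t x with
  | zero => simp [success, hx]
  | succ k ih =>
    have : ∀ᵐ w ∂ν t, success ε S A ν k (t + 1) (step ε S w x) = 1 := by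
      filter_upwards [hν t] with w hw
      exact ih (t + 1) (habs x hx w hw)
    rw [success, lintegral_congr_ae this]
    simp

/-- `forced` allows early arrival, `success` looks at time `k` exactly; absorption reconciles them.
-/
lemma pow_le_success [∀ t, IsProbabilityMeasure (ν t)] (hA : MeasurableSet A)
    (habs : ∀ x ∈ A, ∀ w : Fin n → ℝ, (∀ i, |w i| ≤ δ) → step ε S w x ∈ A)
    (hν : ∀ t, ∀ᵐ w ∂ν t, ∀ i, |w i| ≤ δ)
    (hq : ∀ t, ∀ C ∈ quarters a, q ≤ ν t {w | ∀ i, w i ∈ C}) (hq1 : q ≤ 1)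
    (k t : ℕ) {x : Fin n → ℝ} (hx : x ∈ forced ε δ a S A k) :
    q ^ k ≤ success ε S A ν k t x := by
  induction k generalizing t x with
  | zero => exact (success_of_mem habs hν 0 t hx).symm ▸ (pow_zero q).le
  | succ k ih =>
    rcases hx with hx | ⟨C, hC, h⟩
    · rw [success_of_mem habs hν _ _ hx]
      exact pow_le_one₀ zero_le hq1
    have hsub : ∀ᵐ w ∂ν t, w ∈ {w | ∀ i, w i ∈ C} →
        w ∈ {w | q ^ k ≤ success ε S A ν k (t + 1) (step ε S w x)} := by
      filter_upwards [hν t] with w hw hwC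
      exact ih (t + 1) (h w hwC hw)
    calc q ^ (k + 1) = q ^ k * q := pow_succ q k
      _ ≤ q ^ k * ν t {w | q ^ k ≤ success ε S A ν k (t + 1) (step ε S w x)} := by
          gcongr
          exact (hq t C hC).trans (measure_mono_ae hsub)
      _ ≤ success ε S A ν (k + 1) t x :=
          mul_meas_ge_le_lintegral₀ (((measurable_success hA k (t + 1)).comp
            ((measurable_step ε S).comp measurable_prodMk_left)).aemeasurable) _

variable {Ω : Type*} [MeasurableSpace Ω] {P : Measure Ω} [IsProbabilityMeasure P]
  {X W : ℕ → Ω → Fin n → ℝ}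

/-- The Markov property: `X t` and `W t` have a product joint law, so Fubini integrates out one
noise at a time. -/
lemma measure_eq_lintegral_success (hA : MeasurableSet A) (hX : ∀ t, Measurable (X t))
    (hW : ∀ t, Measurable (W t)) (hXW : ∀ t, IndepFun (X t) (W t) P)
    (hstep : ∀ t ω, X (t + 1) ω = step ε S (W t ω) (X t ω)) (k t : ℕ) :
    P {ω | X (t + k) ω ∈ A} = ∫⁻ ω, success ε S A (fun t => P.map (W t)) k t (X t ω) ∂P := by
  have hprob : ∀ t, IsProbabilityMeasure (P.map (W t)) := fun t =>
    Measure.isProbabilityMeasure_map (hW t).aemeasurable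
  induction k generalizing t with
  | zero =>
    have : (fun ω => success ε S A (fun t => P.map (W t)) 0 t (X t ω))
        = (X t ⁻¹' A).indicator 1 := by
      ext ω
      by_cases h : X t ω ∈ A <;> simp [success, h]
    rw [this, lintegral_indicator_one (hX t hA)]
    rfl
  | succ k ih =>
    have hs := measurable_success (ε := ε) (S := S) (ν := fun t => P.map (W t)) hA k (t + 1)
    have hg : Measurable fun z : (Fin n → ℝ) × (Fin n → ℝ) =>
        success ε S A (fun t => P.map (W t)) k (t + 1) (step ε S z.2 z.1) :=
      hs.comp (measurable_step ε S)
    have hmap := (indepFun_iff_map_prod_eq_prod_map_map (hX t).aemeasurable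
      (hW t).aemeasurable).1 (hXW t)
    rw [show t + (k + 1) = t + 1 + k by ring, ih (t + 1)]
    calc ∫⁻ ω, success ε S A (fun t => P.map (W t)) k (t + 1) (X (t + 1) ω) ∂P
        = ∫⁻ ω, (fun z : (Fin n → ℝ) × (Fin n → ℝ) =>
            success ε S A (fun t => P.map (W t)) k (t + 1) (step ε S z.2 z.1))
              (X t ω, W t ω) ∂P := by simp only [hstep]
      _ = ∫⁻ x, ∫⁻ w, success ε S A (fun t => P.map (W t)) k (t + 1) (step ε S w x)
            ∂(P.map (W t)) ∂(P.map (X t)) := by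
          rw [← lintegral_map hg ((hX t).prodMk (hW t)), hmap, lintegral_prod _ hg.aemeasurable]
      _ = ∫⁻ ω, success ε S A (fun t => P.map (W t)) (k + 1) t (X t ω) ∂P :=
          lintegral_map (measurable_success (ν := fun t => P.map (W t)) hA (k + 1) t) (hX t)

/-- A chain that can be forced into an absorbing set from everywhere reaches it almost surely. -/
lemma ae_exists_mem (hA : MeasurableSet A) (hX : ∀ t, Measurable (X t))
    (hW : ∀ t, Measurable (W t)) (hXW : ∀ t, IndepFun (X t) (W t) P)
    (hstep : ∀ t ω, X (t + 1) ω = step ε S (W t ω) (X t ω)) (hcube : ∀ t ω, X t ω ∈ cube n)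
    (habs : ∀ x ∈ A, ∀ w : Fin n → ℝ, (∀ i, |w i| ≤ δ) → step ε S w x ∈ A)
    (hWδ : ∀ t, ∀ᵐ ω ∂P, ∀ i, |W t ω i| ≤ δ) {p : ℝ} (hp : 0 < p)
    (hWp : ∀ t, ∀ C ∈ quarters a, ENNReal.ofReal p ≤ P {ω | ∀ i, W t ω i ∈ C})
    (hforce : LeadsTo ε δ a S (cube n) A) : ∀ᵐ ω ∂P, ∃ t, X t ω ∈ A := by
  have hprob : ∀ t, IsProbabilityMeasure (P.map (W t)) := fun t =>
    Measure.isProbabilityMeasure_map (hW t).aemeasurable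
  obtain ⟨k, hk⟩ := hforce
  have hq1 : ENNReal.ofReal p ≤ 1 :=
    (hWp 0 (Set.Ici a) (by simp [quarters])).trans prob_le_one
  have hp1 : p ≤ 1 := ENNReal.ofReal_le_one.1 hq1
  have hboundMeas : MeasurableSet {w : Fin n → ℝ | ∀ i, |w i| ≤ δ} := by
    have : {w : Fin n → ℝ | ∀ i, |w i| ≤ δ} = ⋂ i, {w | |w i| ≤ δ} := by ext; simp
    rw [this]
    exact MeasurableSet.iInter fun i => measurableSet_le (by fun_prop) measurable_const
  have hν : ∀ t, ∀ᵐ w ∂(P.map (W t)), ∀ i, |w i| ≤ δ := fun t =>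
    (ae_map_iff (hW t).aemeasurable hboundMeas).2 (hWδ t)
  have hq : ∀ t, ∀ C ∈ quarters a, ENNReal.ofReal p ≤ P.map (W t) {w | ∀ i, w i ∈ C} :=
    fun t C hC => (hWp t C hC).trans (Measure.le_map_apply (hW t).aemeasurable _)
  have hXA : ∀ t, MeasurableSet {ω | X t ω ∈ A} := fun t => hX t hA
  -- Paths in `A` stay there; elsewhere the next `k` steps succeed with probability at least `p ^
  -- k`, whatever the current profile.
  have hrec : ∀ t, P.real {ω | X (t + k) ω ∉ A} ≤ (1 - p ^ k) * P.real {ω | X t ω ∉ A} := by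
    intro t
    have h1 : P {ω | X t ω ∈ A} + ENNReal.ofReal p ^ k * P {ω | X t ω ∉ A}
        ≤ P {ω | X (t + k) ω ∈ A} := by
      rw [measure_eq_lintegral_success hA hX hW hXW hstep k t, ← lintegral_add_compl _ (hXA t)]
      refine add_le_add ?_ ?_
      · rw [← setLIntegral_one]
        refine setLIntegral_mono' (hXA t) fun ω hω => ?_
        rw [success_of_mem habs hν k t hω]
      · have : {ω | X t ω ∈ A}ᶜ = {ω | X t ω ∉ A} := rfl
        rw [this, ← setLIntegral_const]
        exact lintegral_mono fun ω => pow_le_success hA habs hν hq hq1 k t (hk (hcube t ω))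
    have h2 := ENNReal.toReal_mono (measure_ne_top _ _) h1
    rw [ENNReal.toReal_add (measure_ne_top _ _)
      (ENNReal.mul_ne_top (by finiteness) (measure_ne_top _ _)), ENNReal.toReal_mul,
      ENNReal.toReal_pow, ENNReal.toReal_ofReal hp.le] at h2
    have hcompl : ∀ t, P.real {ω | X t ω ∉ A} = 1 - P.real {ω | X t ω ∈ A} := fun t =>
      probReal_compl_eq_one_sub (hXA t)
    have h3 : P.real {ω | X t ω ∈ A} + p ^ k * P.real {ω | X t ω ∉ A}
      ≤ P.real {ω | X (t + k) ω ∈ A} := h2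
    have h4 := hcompl t
    have h5 := hcompl (t + k)
    linarith
  have hgeom : ∀ m : ℕ, P.real {ω | X (m * k) ω ∉ A} ≤ (1 - p ^ k) ^ m := by
    intro m
    induction m with
    | zero => simp [measureReal_le_one]
    | succ m ih =>
      rw [Nat.succ_mul, pow_succ']
      exact (hrec _).trans (mul_le_mul_of_nonneg_left ih (by
        linarith [pow_le_one₀ hp.le hp1 (n := k)]))
  have hzero : P.real {ω | ∀ t, X t ω ∉ A} ≤ 0 := by
    refine ge_of_tendsto' (tendsto_pow_atTop_nhds_zero_of_lt_one
      (by linarith [pow_le_one₀ hp.le hp1 (n := k)] : 0 ≤ 1 - p ^ k)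
      (by linarith [pow_pos hp k])) fun m => ?_
    have hsub : {ω | ∀ t, X t ω ∉ A} ⊆ {ω | X (m * k) ω ∉ A} := fun ω hω => hω (m * k)
    exact (measureReal_mono hsub).trans (hgeom m)
  rw [ae_iff]
  have := le_antisymm hzero measureReal_nonneg
  rw [measureReal_eq_zero_iff] at this
  simpa using this

end Chain

/-! ### The trajectory as a chain with independent noise. -/

section Trajectory

variable {n : ℕ} {ε δ : ℝ} {S : Finset (Fin n)}

lemma diam_le_iff [Nonempty (Fin n)] {x : Fin n → ℝ} {r : ℝ} :
    diam x ≤ r ↔ ∀ i j, |x i - x j| ≤ r :=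
  ⟨fun h i j => (le_ciSup (f := fun q : Fin n × Fin n => |x q.1 - x q.2|)
    (Set.finite_range _).bddAbove (i, j)).trans h, fun h => ciSup_le fun q => h q.1 q.2⟩

lemma exists_of_quasiConsensusTime_lt {x : ℕ → Fin n → ℝ} {t : ℕ}
    (h : quasiConsensusTime ε x < t) : ∃ s < t, ∀ t', s ≤ t' → diam (x t') ≤ ε := by
  simp only [quasiConsensusTime, iInf_lt_iff] at h
  obtain ⟨s, hs, hst⟩ := h
  exact ⟨s, by exact_mod_cast hst, hs⟩

lemma quasiConsensusTime_lt_top {x : ℕ → Fin n → ℝ} {s : ℕ}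
    (h : ∀ t', s ≤ t' → diam (x t') ≤ ε) : quasiConsensusTime ε x < ⊤ :=
  (iInf₂_le s h).trans_lt (ENat.natCast_lt_top s)

lemma state_mem_cube {x₀ : Fin n → ℝ} (hx₀ : x₀ ∈ cube n) (w : Fin n → ℕ+ → ℝ) (t : ℕ) :
    state ε S w x₀ t ∈ cube n := by
  cases t with
  | zero => exact hx₀
  | succ t => exact step_mem_cube ε S _ _

/-- Only noises up to time `t` are assumed measurable, so that the lemma also applies to the
σ-algebra they generate. -/
lemma measurable_state {Ω : Type*} [MeasurableSpace Ω] {ξ : Fin n → ℕ+ → Ω → ℝ}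
    (x₀ : Fin n → ℝ) (t : ℕ) (h : ∀ i (s : ℕ+), (s : ℕ) ≤ t → Measurable (ξ i s)) :
    Measurable fun ω => state ε S (fun i s => ξ i s ω) x₀ t := by
  induction t with
  | zero => exact measurable_const
  | succ t ih =>
    have hW : Measurable fun ω i => ξ i t.succPNat ω :=
      measurable_pi_lambda _ fun i => h i _ le_rfl
    have hX := ih fun i s hs => h i s (Nat.le_succ_of_le hs)
    have hpair : Measurable fun ω =>
        (state ε S (fun i s => ξ i s ω) x₀ t, fun i => ξ i t.succPNat ω) := hX.prodMk hW
    have hcomp := (measurable_step ε S).comp hpair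
    simpa only [state, Function.comp_def] using hcomp

variable {Ω : Type*} [MeasurableSpace Ω] {P : Measure Ω} {ξ : Fin n → ℕ+ → Ω → ℝ}

lemma indepFun_state (hmeas : ∀ i t, Measurable (ξ i t))
    (hindep : iIndepFun (fun q : Fin n × ℕ+ => ξ q.1 q.2) P) (x₀ : Fin n → ℝ) (t : ℕ) :
    IndepFun (fun ω => state ε S (fun i s => ξ i s ω) x₀ t)
      (fun ω i => ξ i t.succPNat ω) P := by
  rw [IndepFun_iff_Indep]
  let m : Fin n × ℕ+ → MeasurableSpace Ω := fun q => MeasurableSpace.comap (ξ q.1 q.2) inferInstance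
  have hd : Disjoint {q : Fin n × ℕ+ | (q.2 : ℕ) ≤ t} {q | q.2 = t.succPNat} := by
    refine Set.disjoint_left.2 fun q (h1 : (q.2 : ℕ) ≤ t) (h2 : q.2 = t.succPNat) => ?_
    rw [h2, Nat.succPNat_coe] at h1
    omega
  have hind : iIndep m P := (iIndepFun_iff_iIndep _ _ _).1 hindep
  have hle : ∀ (T : Set (Fin n × ℕ+)) (i : Fin n) (s : ℕ+), (i, s) ∈ T →
      Measurable[⨆ q ∈ T, m q] (ξ i s) := fun T i s hs =>
    (comap_measurable (ξ i s)).mono (le_biSup m hs) le_rfl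
  refine indep_of_indep_of_le_left (indep_of_indep_of_le_right
    (indep_iSup_of_disjoint (fun q => (hmeas q.1 q.2).comap_le) hind hd) ?_) ?_
  · exact Measurable.comap_le (@measurable_pi_lambda _ _ _ (_) _ _ fun i => hle _ i _ rfl)
  · exact Measurable.comap_le (@measurable_state _ _ _ _ (_) _ x₀ t fun i s hs => hle _ i s hs)

lemma pow_le_measure_forall_mem (hindep : iIndepFun (fun q : Fin n × ℕ+ => ξ q.1 q.2) P)
    {C : Set ℝ} (hC : MeasurableSet C) {p : ℝ} (hp : 0 ≤ p) (t : ℕ+)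
    (h : ∀ i, ENNReal.ofReal p ≤ P {ω | ξ i t ω ∈ C}) :
    ENNReal.ofReal (p ^ n) ≤ P {ω | ∀ i, ξ i t ω ∈ C} := by
  have hi : iIndepFun (fun i => ξ i t) P :=
    hindep.precomp (g := fun i : Fin n => (i, t)) fun i j hij => (Prod.ext_iff.1 hij).1
  have hset : {ω | ∀ i, ξ i t ω ∈ C} = ⋂ i, ξ i t ⁻¹' C := by ext; simp
  rw [hset, hi.meas_iInter fun i => ⟨C, hC, rfl⟩, ENNReal.ofReal_pow hp]
  calc ENNReal.ofReal p ^ n = ∏ _i : Fin n, ENNReal.ofReal p := by simp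
    _ ≤ ∏ i, P (ξ i t ⁻¹' C) := Finset.prod_le_prod' fun i _ => h i

end Trajectory

end NoisyHK

/-! ### The main theorem. -/

theorem theorem2 {Ω : Type*} [MeasurableSpace Ω] (P : Measure Ω) [IsProbabilityMeasure P]
    (n : ℕ) (S : Finset (Fin n)) (hS : S.Nonempty)
    (ε : ℝ) (hε : ε ∈ Set.Ioc (0 : ℝ) 1)
    (x₀ : Fin n → ℝ) (hx₀ : ∀ i, x₀ i ∈ Set.Icc (0 : ℝ) 1)
    (ξ : Fin n → ℕ+ → Ω → ℝ)
    (hmeas : ∀ i t, Measurable (ξ i t))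
    (hindep : iIndepFun (fun q : Fin n × ℕ+ => ξ q.1 q.2) P)
    (δ : ℝ) (hδ : 0 < δ)
    (hδ_one : S.card = 1 → δ ≤ ε) (hδ_many : 1 < S.card → δ ≤ ε / 2)
    (hbound : ∀ i t, P {ω | |ξ i t ω| ≤ δ} = 1)
    (hnondeg : ∃ a ∈ Set.Ioo (0 : ℝ) δ, ∃ p ∈ Set.Ioo (0 : ℝ) 1, ∀ i t,
      p ≤ P.real {ω | a ≤ ξ i t ω} ∧
      p ≤ P.real {ω | 0 ≤ ξ i t ω ∧ ξ i t ω ≤ a} ∧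
      p ≤ P.real {ω | ξ i t ω ≤ -a} ∧
      p ≤ P.real {ω | -a ≤ ξ i t ω ∧ ξ i t ω ≤ 0}) :
    ∀ᵐ ω ∂P,
      NoisyHK.quasiConsensusTime ε (NoisyHK.state ε S (fun i t => ξ i t ω) x₀) < ⊤ ∧
      ∀ t : ℕ,
        NoisyHK.quasiConsensusTime ε (NoisyHK.state ε S (fun i t => ξ i t ω) x₀) < (t : ℕ∞) →
        (S.card = 1 → NoisyHK.diam (NoisyHK.state ε S (fun i t => ξ i t ω) x₀ t) ≤ δ) ∧
        (1 < S.card → NoisyHK.diam (NoisyHK.state ε S (fun i t => ξ i t ω) x₀ t) ≤ 2 * δ) := by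
  open NoisyHK in
  obtain ⟨a, ⟨ha, haδ⟩, p, ⟨hp, hp1⟩, hnd⟩ := hnondeg
  obtain ⟨s, -⟩ := id hS
  have : Nonempty (Fin n) := ⟨s⟩
  have hn : (0 : ℝ) < n := by exact_mod_cast s.pos
  have hε0 := hε.1
  have hδε : δ ≤ ε := by
    rcases (Nat.succ_le_of_lt hS.card_pos).eq_or_lt with h | h
    · exact hδ_one h.symm
    · linarith [hδ_many h]
  have hSδ : (∃ i, S = {i}) ∨ δ ≤ ε / 2 := by
    rcases (Nat.succ_le_of_lt hS.card_pos).eq_or_lt with h | h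
    · exact Or.inl (Finset.card_eq_one.1 h.symm)
    · exact Or.inr (hδ_many h)
  have hm : Margins n ε δ a (min (min (ε / n) a) (min (ε / 2) (ε - a))) :=
    { eps_pos := hε0
      delta_le := hδε
      c_pos := lt_min (lt_min (div_pos hε0 hn) ha) (lt_min (by linarith) (by linarith))
      c_le_div := (min_le_left _ _).trans (min_le_left _ _)
      c_le_a := (min_le_left _ _).trans (min_le_right _ _)
      two_c_le := by
        have := (min_le_right (min (ε / n) a) (min (ε / 2) (ε - a))).trans (min_le_left _ _)
        linarith
      c_le_sub := (min_le_right _ _).trans (min_le_right _ _) }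
  have hae : ∀ᵐ ω ∂P, ∀ i t, |ξ i t ω| ≤ δ := by
    rw [ae_all_iff]; intro i
    rw [ae_all_iff]; intro t
    refine (mem_ae_iff_prob_eq_one ?_).2 (hbound i t)
    exact measurableSet_le (by have := hmeas i t; fun_prop) measurable_const
  have hle : ∀ {s : Set Ω}, p ≤ P.real s → ENNReal.ofReal p ≤ P s := fun h =>
    ENNReal.ofReal_le_of_le_toReal h
  have hquarter : ∀ (t : ℕ), ∀ C ∈ quarters a,
      ENNReal.ofReal (p ^ n) ≤ P {ω | ∀ i, ξ i t.succPNat ω ∈ C} := by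
    rintro t C (rfl | rfl | rfl | rfl)
    · exact pow_le_measure_forall_mem hindep measurableSet_Ici hp.le _ fun i => hle (hnd i _).1
    · exact pow_le_measure_forall_mem hindep measurableSet_Icc hp.le _ fun i => hle (hnd i _).2.1
    · exact pow_le_measure_forall_mem hindep measurableSet_Iic hp.le _ fun i => hle (hnd i _).2.2.1
    · exact pow_le_measure_forall_mem hindep measurableSet_Icc hp.le _ fun i => hle (hnd i _).2.2.2
  have hreach := ae_exists_mem (P := P) (ε := ε) (S := S) (δ := δ) (a := a)
    (X := fun t ω => state ε S (fun i s => ξ i s ω) x₀ t)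
    (W := fun t ω i => ξ i t.succPNat ω) (measurableSet_agreement n ε)
    (fun t => measurable_state x₀ t fun i s _ => hmeas i s)
    (fun t => measurable_pi_lambda _ fun i => hmeas i _)
    (fun t => indepFun_state hmeas hindep x₀ t) (fun t ω => rfl)
    (fun t ω => state_mem_cube hx₀ _ t)
    (fun x hx w hw => step_mem_agreement hδ.le hS hδ_one hδ_many hw hx)
    (fun t => hae.mono fun ω hω i => hω i _) (pow_pos hp n) hquarter
    (cube_leadsTo_agreement hm hS hSδ)
  filter_upwards [hae, hreach] with ω hω ⟨t, ht⟩
  have hstay : ∀ t', t ≤ t' → diam (state ε S (fun i s => ξ i s ω) x₀ t') ≤ ε := by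
    intro t' htt'
    rw [diam_le_iff]
    induction t', htt' using Nat.le_induction with
    | base => exact ht
    | succ t' _ ih =>
      exact step_mem_agreement hδ.le hS hδ_one hδ_many (fun i => hω i _) ih
  refine ⟨quasiConsensusTime_lt_top hstay, fun t' ht' => ?_⟩
  obtain ⟨u, hut, hu⟩ := exists_of_quasiConsensusTime_lt ht'
  -- Since `u < t'` strictly, the profile one step before `t'` is already in agreement, and its step
  -- gives the sharper bound.
  obtain ⟨r, rfl⟩ := Nat.exists_eq_add_of_lt hut
  have hr : state ε S (fun i s => ξ i s ω) x₀ (u + r) ∈ agreement n ε :=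
    diam_le_iff.1 (hu _ (Nat.le_add_right u r))
  exact ⟨fun h1 => diam_le_iff.2
      (abs_step_sub_step_le_of_card_eq_one hr hδ.le (fun i => hω i _) h1),
    fun _ => diam_le_iff.2 (abs_step_sub_step_le_two_mul hr hδ.le fun i => hω i _)⟩
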